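/- Let $k$ be a field, let $\kappa$ be an infinite cardinal with $\kappa\ge |k|$, let $J$ be a set of cardinality $\kappa$, and let $S$ be a $k$-scheme of finite type. For an open subset $V\subseteq S$ with inclusion $i_V:V\to S$ put $\mathcal{O}_{S,V}:=(i_V)_!\mathcal{O}_V$, where the extension by zero functor $(i_V)_!$ is the left adjoint of the inverse image functor $i_V^*$ on modules. Let $\mathcal{D}_S$ be the full subcategory of the category of $\mathcal{O}_S$-modules whose objects are the modules $\bigoplus_{j\in J}\mathcal{O}_{S,V_j}$ for all functions $j\mapsto V_j$ from $J$ to the set of open subsets of $S$. Let $E$ be a cochain complex of $\mathcal{O}_S$-modules such that (i) $E$ is cohomologically bounded above, i.e. there is a natural number $N$ with $H^n(E)=0$ for all $n\ge N$; and (ii) $|H^n(E)(U)|\le\kappa$ for all $n\in\mathbb{Z}$ and all open $U\subseteq S$, where $H^n(E)$ is the $n$-th cohomology sheaf of $E$. Then there exist a (strictly) bounded above complex $F$ all of whose terms are objects of $\mathcal{D}_S$, and a morphism of complexes $F\to E$ that is a quasi-isomorphism. Moreover, every perfect complex of $\mathcal{O}_S$-modules (i.e. every complex that is locally on $S$ quasi-isomorphic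 to a strictly bounded complex of locally free modules of finite rank) satisfies (i) and (ii). -/

import Mathlib

open CategoryTheory CategoryTheory.Limits AlgebraicGeometry
open scoped Cardinal AlgebraicGeometry

universe u

namespace AlgebraicGeometry.Scheme.Modules

section ExtensionByZero

variable {X Y : Scheme.{u}} (f : X ⟶ Y) [IsOpenImmersion f]

instance restrictFunctor_additive : (restrictFunctor f).Additive where
  map_add := rfl

/-- The direct image of sheaves of modules along a continuous functor of small sites has a left
adjoint. -/
theorem pushforward_isRightAdjoint_of_small {C D : Type u} [SmallCategory C] [SmallCategory D]
    {J : GrothendieckTopology C} {K : GrothendieckTopology D} {F : C ⥤ D}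
    {R : Sheaf J RingCat.{u}} {R' : Sheaf K RingCat.{u}} [F.IsContinuous J K]
    [HasWeakSheafify K AddCommGrpCat.{u}] [K.WEqualsLocallyBijective AddCommGrpCat.{u}]
    (φ : R ⟶ (F.sheafPushforwardContinuous RingCat.{u} J K).obj R') :
    (SheafOfModules.pushforward.{u} φ).IsRightAdjoint := by
  have h : ∀ ψ : R.obj ⟶ F.op ⋙ R'.obj, (PresheafOfModules.pushforward.{u} ψ).IsRightAdjoint :=
    fun ψ ↦ inferInstance
  have h' : (PresheafOfModules.pushforward.{u} φ.hom).IsRightAdjoint := h φ.hom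
  exact (SheafOfModules.PullbackConstruction.adjunction.{u} φ).isRightAdjoint

/-- The inverse image of modules along an open immersion has a left adjoint. -/
instance restrictFunctor_isRightAdjoint : (restrictFunctor f).IsRightAdjoint :=
  pushforward_isRightAdjoint_of_small _

/-- Extension by zero `f_!` of modules along an open immersion `f`: the left adjoint of the
inverse image functor `f^*`. -/
noncomputable def extensionByZero : X.Modules ⥤ Y.Modules :=
  (restrictFunctor f).leftAdjoint

/-- The adjunction `f_! ⊣ f^*` for an open immersion `f`. -/
noncomputable def extensionByZeroAdjunction : extensionByZero f ⊣ restrictFunctor f :=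
  Adjunction.ofIsRightAdjoint (restrictFunctor f)

end ExtensionByZero

/-- The structure sheaf `𝒪_X` as a module over itself. -/
noncomputable def structureSheafModule (X : Scheme.{u}) : X.Modules :=
  SheafOfModules.unit X.ringCatSheaf

/-- The `𝒪_S`-module `𝒪_{S,V} = (i_V)_! 𝒪_V`, for an open subset `V` of `S` with inclusion
`i_V : V ⟶ S`. -/
noncomputable def extendedStructureSheaf (S : Scheme.{u}) (V : S.Opens) : S.Modules :=
  (extensionByZero V.ι).obj (structureSheafModule (V : Scheme.{u}))

/-- The class of objects of the full subcategory `𝒟_S` of `Mod(S)`: the direct sums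
`⨁_{j ∈ J} 𝒪_{S,V_j}` for all functions `V : J → Op(S)`. -/
def directSumProperty (S : Scheme.{u}) (J : Type u) : ObjectProperty S.Modules :=
  ObjectProperty.ofObj fun V : J → S.Opens ↦ ∐ fun j ↦ extendedStructureSheaf S (V j)

variable {X : Scheme.{u}}

/-- A cochain complex of modules is cohomologically bounded above if its cohomology sheaves vanish
in all sufficiently large degrees. -/
def IsCohomologicallyBoundedAbove (E : CochainComplex X.Modules ℤ) : Prop :=
  ∃ N : ℕ, ∀ n : ℤ, (N : ℤ) ≤ n → IsZero (E.homology n)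

/-- All sections over all open subsets of all cohomology sheaves of `E` form sets of cardinality at
most `κ`. -/
def HasCohomologySectionsLE (κ : Cardinal.{u}) (E : CochainComplex X.Modules ℤ) : Prop :=
  ∀ (n : ℤ) (U : X.Opens), #Γ(E.homology n, U) ≤ κ

/-- Algebraic vector bundles: modules that are locally free of finite rank. -/
def IsVectorBundle (M : X.Modules) : Prop :=
  ∀ x : X, ∃ U : X.Opens, x ∈ U ∧ ∃ r : ℕ,
    Nonempty (M.restrict U.ι ≅ ∐ fun _ : Fin r ↦ structureSheafModule (U : Scheme.{u}))

/-- Strictly perfect complexes: strictly bounded complexes of algebraic vector bundles. -/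
def IsStrictlyPerfect (P : CochainComplex X.Modules ℤ) : Prop :=
  (∃ a b : ℤ, P.IsStrictlyGE a ∧ P.IsStrictlyLE b) ∧ ∀ n : ℤ, IsVectorBundle (P.X n)

/-- Two complexes are quasi-isomorphic, that is, isomorphic in the derived category: they are joined
by a roof `E ⟵ G ⟶ E'` of quasi-isomorphisms. -/
def AreQuasiIsomorphic (E E' : CochainComplex X.Modules ℤ) : Prop :=
  ∃ (G : CochainComplex X.Modules ℤ) (s : G ⟶ E) (t : G ⟶ E'), QuasiIso s ∧ QuasiIso t

/-- The restriction of a complex of modules to an open subset. -/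
noncomputable def restrictComplex (E : CochainComplex X.Modules ℤ) (U : X.Opens) :
    CochainComplex (U : Scheme.{u}).Modules ℤ :=
  ((restrictFunctor U.ι).mapHomologicalComplex (ComplexShape.up ℤ)).obj E

/-- Perfect complexes: complexes of modules which are locally quasi-isomorphic to strictly perfect
complexes. -/
def IsPerfect (E : CochainComplex X.Modules ℤ) : Prop :=
  ∀ x : X, ∃ U : X.Opens, x ∈ U ∧ ∃ P : CochainComplex (U : Scheme.{u}).Modules ℤ,
    IsStrictlyPerfect P ∧ AreQuasiIsomorphic P (restrictComplex E U)

end AlgebraicGeometry.Scheme.Modules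

/-! The complex `F` is built by descending induction on the degree, starting from zero where the
cohomology of `E` vanishes. Suppose the cycles `Z` of `F` in degree m + 1 are known and surject onto
the cohomology of `E` there. The next term must do two things: cover the kernel K of this
surjection, so that the excess classes become boundaries, and supply new cycles that cover the
cohomology of `E` in degree m. A direct sum of two objects of 𝒟_S does both
(`ResolutionStage.exists_extends`).

Each summand comes from the covering property `HasOpensLE.exists_epi_of_epi`: for an epimorphism M →
N whose target has at most κ sections over each open set, some object of 𝒟_S maps to M with
epimorphic composite to N. Nothing is asked of M, so only the cohomology of `E` needs a bound, not
its terms. For K the bound holds because K is a subobject of an object of 𝒟_S, and such objects have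
small sections.

All bounds rest on two facts. A scheme of finite type over k is Noetherian with at most κ open sets,
and on such a space a section is determined by finitely many local data (`HasOpensLE.sections_le`).
Hence smallness of sections passes to quotients and associated sheaves and may be checked locally.
For perfect complexes the claim thus reduces to subquotients of vector bundles, and
quasi-compactness makes the local upper bounds uniform. -/

namespace CochainComplex

universe v w

/-! ### Resolutions built from the right in an abelian category. -/

/-- Downward dependent choice along the integers. -/
theorem exists_descending_family {T : ℤ → Type w} (R : ∀ m, T m → T (m + 1) → Prop) (N : ℤ)
    (t₀ : ∀ m, N ≤ m → T m)
    (h₀ : ∀ m (hm : N ≤ m), R m (t₀ m hm) (t₀ (m + 1) (by omega)))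
    (step : ∀ m (t : T (m + 1)), ∃ t' : T m, R m t' t) :
    ∃ s : ∀ m, T m, (∀ m, R m (s m) (s (m + 1))) ∧ ∀ m (hm : N ≤ m), s m = t₀ m hm := by
  choose g hg using step
  -- `Int.inductionOn'` descends from k to k - 1, whereas `g` goes from m + 1 to m; the transports
  -- reconcile the two indexings.
  have key : ∀ m, ∃ g' : T m → T (m - 1), ∀ m' (h : m' + 1 = m) (h' : m - 1 = m') (t : T m),
      R m' (h' ▸ g' t) (h ▸ t) := by
    intro m
    obtain ⟨m, rfl⟩ : ∃ k, m = k + 1 := ⟨m - 1, by ring⟩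
    refine ⟨fun t ↦ (show m = m + 1 - 1 by ring) ▸ g m t, ?_⟩
    intro m' h h' t
    obtain rfl : m' = m := by omega
    have aux : ∀ k (a : m' = k) (b : k = m') (x : T m'), b ▸ (a ▸ x : T k) = x := by
      rintro _ rfl _ _; rfl
    rw [aux]
    exact hg m' t
  choose g' hg' using key
  let s : ∀ m, T m := fun m ↦ Int.inductionOn' (motive := T) m N (t₀ N le_rfl)
    (fun k hk _ ↦ t₀ (k + 1) (by omega)) (fun k _ t ↦ g' k t)
  have hs : ∀ m (hm : N ≤ m), s m = t₀ m hm := by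
    intro m hm
    obtain rfl | hm := hm.eq_or_lt
    · exact Int.inductionOn'_self
    · obtain ⟨k, rfl⟩ : ∃ k, m = k + 1 := ⟨m - 1, by ring⟩
      exact Int.inductionOn'_add_one (by omega)
  refine ⟨s, fun m ↦ ?_, hs⟩
  by_cases hm : N ≤ m
  · have := h₀ m hm
    rwa [← hs m hm, ← hs (m + 1) (by omega)] at this
  · have h1 : s (m + 1 - 1) = g' (m + 1) (s (m + 1)) :=
      Int.inductionOn'_sub_one (by omega)
    have h2 := hg' (m + 1) m rfl (by ring) (s (m + 1))
    rw [← h1] at h2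
    have h3 : ∀ k (h : k = m), h ▸ s k = s m := by rintro _ rfl; rfl
    rw [h3] at h2
    exact h2

variable {C : Type u} [Category.{v} C] [Abelian C] (E : CochainComplex C ℤ)

/-- The data in one degree used to build a resolution of a complex from the right: a term with a
map to the complex, and its cycles, which surject onto the cohomology of the complex. -/
structure ResolutionStage (P : ObjectProperty C) (m : ℤ) where
  /-- the term -/
  A : C
  /-- the cycles of the term -/
  Z : C
  prop : P A
  f : A ⟶ E.X m
  i : Z ⟶ A
  mono_i : Mono i
  z : Z ⟶ E.cycles m
  z_fac : z ≫ E.iCycles m = i ≫ f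
  epi : Epi (z ≫ E.homologyπ m)

variable {E}

/-- Compatibility of two successive stages. -/
structure ResolutionStage.Extends {P : ObjectProperty C} {m : ℤ} (t' : ResolutionStage E P m)
    (t : ResolutionStage E P (m + 1)) : Prop where
  exists_d : ∃ δ : t'.A ⟶ t.Z, t'.f ≫ E.d m (m + 1) = δ ≫ t.i ≫ t.f ∧ t'.i ≫ δ = 0 ∧
    (∀ ⦃T : C⦄ (x : T ⟶ t'.A), x ≫ δ = 0 → ∃ y, x = y ≫ t'.i) ∧
    ∀ ⦃T : C⦄ (x : T ⟶ t.Z), x ≫ t.z ≫ E.homologyπ (m + 1) = 0 →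
      ∃ (T' : C) (π : T' ⟶ T) (_ : Epi π) (y : T' ⟶ t'.A), π ≫ x = y ≫ δ

theorem ResolutionStage.exists_extends {P Q : ObjectProperty C} [Q.IsClosedUnderSubobjects]
    (hPQ : P ≤ Q)
    (hP : ∀ ⦃A B : C⦄, P A → P B → ∃ D, P D ∧ Nonempty (D ≅ A ⊞ B))
    (hPe : ∀ ⦃X K : C⦄ (p : X ⟶ K) [Epi p], Q K → ∃ (A : C) (a : A ⟶ X), P A ∧ Epi (a ≫ p))
    (hE : ∀ n, Q (E.homology n)) {m : ℤ} (t : ResolutionStage E P (m + 1)) :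
    ∃ t' : ResolutionStage E P m, t'.Extends t := by
  have := t.mono_i
  have := t.epi
  have hQZ : Q t.Z := Q.prop_of_mono t.i (hPQ _ t.prop)
  let q := t.z ≫ E.homologyπ (m + 1)
  have hQK : Q (kernel q) := Q.prop_of_mono (kernel.ι q) hQZ
  -- A cycle with zero cohomology class is a boundary after refinement, so elements of `kernel q`
  -- lift to `E.X m` up to refinement.
  have : Epi (pullback.fst (kernel.ι q ≫ t.z) (E.toCycles m (m + 1))) := by
    rw [epi_iff_surjective_up_to_refinements]
    intro T y
    obtain ⟨T', π, hπ, x, hx⟩ := (E.comp_homologyπ_eq_zero_iff_up_to_refinements m (m + 1)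
      (by simp) (y ≫ kernel.ι q ≫ t.z)).1 (by
        have : kernel.ι q ≫ t.z ≫ E.homologyπ (m + 1) = 0 := kernel.condition q
        simp [this])
    exact ⟨T', π, hπ, pullback.lift (π ≫ y) x (by simpa using hx), (pullback.lift_fst _ _ _).symm⟩
  obtain ⟨A₁, a₁, hA₁, _⟩ := hPe (pullback.fst (kernel.ι q ≫ t.z) (E.toCycles m (m + 1))) hQK
  obtain ⟨A₂, a₂, hA₂, _⟩ := hPe (E.homologyπ m) (hE m)
  obtain ⟨A, hA, ⟨e⟩⟩ := hP hA₁ hA₂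
  let δ₁ : A₁ ⟶ kernel q := a₁ ≫ pullback.fst _ _
  have hδ₁ : Epi δ₁ := ‹_›
  -- `A₁` makes the image of `δ` equal to `kernel q`; `A₂` is killed by `δ`, so it lies in the new
  -- cycles and makes them surject onto the cohomology in degree `m`.
  let δ : A ⟶ t.Z := e.hom ≫ biprod.desc (δ₁ ≫ kernel.ι q) 0
  let f : A ⟶ E.X m := e.hom ≫ biprod.desc (a₁ ≫ pullback.snd _ _) (a₂ ≫ E.iCycles m)
  have hf : f ≫ E.d m (m + 1) = δ ≫ t.z ≫ E.iCycles (m + 1) := by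
    simp only [f, δ, Category.assoc]
    congr 1
    ext
    · simp only [δ₁, biprod.inl_desc_assoc, Category.assoc]
      have := pullback.condition (f := kernel.ι q ≫ t.z) (g := E.toCycles m (m + 1))
      rw [← E.toCycles_i m (m + 1), ← reassoc_of% this]
    · simp
  have hf' : f ≫ E.d m (m + 1) = δ ≫ t.i ≫ t.f := by rw [hf, t.z_fac]
  let z : kernel δ ⟶ E.cycles m := E.liftCycles (kernel.ι δ ≫ f) (m + 1) (by simp) (by
    simp [hf])
  let j : A₂ ⟶ kernel δ := kernel.lift δ (biprod.inr ≫ e.inv) (by simp [δ])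
  have hj : j ≫ z = a₂ := by
    rw [← cancel_mono (E.iCycles m)]
    simp [j, z, f]
  refine ⟨⟨A, kernel δ, hA, f, kernel.ι δ, inferInstance, z, by simp [z], ?_⟩, ⟨δ, hf',
    kernel.condition δ, fun T x hx ↦ ⟨kernel.lift δ x hx, by simp⟩, fun T x hx ↦ ?_⟩⟩
  · have : Epi (j ≫ z ≫ E.homologyπ m) := by rw [reassoc_of% hj]; infer_instance
    exact epi_of_epi j _
  · obtain ⟨T', π, hπ, y, hy⟩ := surjective_up_to_refinements_of_epi δ₁ (kernel.lift q x hx)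
    refine ⟨T', π, hπ, y ≫ biprod.inl ≫ e.inv, ?_⟩
    have := congr($hy ≫ kernel.ι q)
    simp only [Category.assoc, kernel.lift_ι] at this
    simp [δ, this]

/-- Since `i` is mono, the cycles of `F` are the objects `Z`, and the boundaries are exactly the
kernel of `Z` onto the cohomology of `E`; so `F` and `E` have the same cohomology. -/
theorem exists_quasiIso_of_objectProperty (P Q : ObjectProperty C) [Q.IsClosedUnderSubobjects]
    (hPQ : P ≤ Q) (hP₀ : ∃ A, P A ∧ IsZero A)
    (hP : ∀ ⦃A B : C⦄, P A → P B → ∃ D, P D ∧ Nonempty (D ≅ A ⊞ B))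
    (hPe : ∀ ⦃X K : C⦄ (p : X ⟶ K) [Epi p], Q K → ∃ (A : C) (a : A ⟶ X), P A ∧ Epi (a ≫ p))
    (hE : ∀ n, Q (E.homology n)) (N : ℤ) (hN : ∀ n, N ≤ n → IsZero (E.homology n)) :
    ∃ (F : CochainComplex C ℤ) (φ : F ⟶ E),
      (∀ n : ℤ, P (F.X n)) ∧ (∃ N : ℤ, F.IsStrictlyLE N) ∧ QuasiIso φ := by
  obtain ⟨A₀, hA₀, hA₀'⟩ := hP₀
  let t₀ : ∀ m, N ≤ m → ResolutionStage E P m := fun m hm ↦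
    { A := A₀, Z := A₀, prop := hA₀, f := 0, i := 𝟙 A₀, mono_i := inferInstance, z := 0
      z_fac := by simp
      epi := ⟨fun _ _ _ ↦ (hN m hm).eq_of_src _ _⟩ }
  obtain ⟨s, hs, hs₀⟩ := exists_descending_family (T := ResolutionStage E P)
    (R := fun _ t' t ↦ t'.Extends t) N t₀
    (fun m hm ↦ ⟨0, by simp [t₀], by simp [t₀], fun T x _ ↦ ⟨0, hA₀'.eq_of_tgt _ _⟩,
      fun T x _ ↦ ⟨T, 𝟙 T, inferInstance, 0, hA₀'.eq_of_tgt _ _⟩⟩)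
    (fun m t ↦ t.exists_extends hPQ hP hPe hE)
  choose δ hδ₁ hδ₂ hδ₃ hδ₄ using fun m ↦ (hs m).exists_d
  let F : CochainComplex C ℤ := .of (fun m ↦ (s m).A) (fun m ↦ δ m ≫ (s (m + 1)).i) (fun m ↦ by
    simp [reassoc_of% (hδ₂ (m + 1))])
  have hF : ∀ m, F.d m (m + 1) = δ m ≫ (s (m + 1)).i := fun m ↦ CochainComplex.of_d (fun m ↦ (s m).A) (fun m ↦ δ m ≫ (s (m + 1)).i) m
  let φ : F ⟶ E :=
    { f := fun m ↦ (s m).f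
      comm' := by
        rintro m _ rfl
        rw [hF, Category.assoc, hδ₁] }
  refine ⟨F, φ, fun n ↦ (s n).prop, ⟨N, ?_⟩, ⟨fun n ↦ ?_⟩⟩
  · rw [CochainComplex.isStrictlyLE_iff]
    intro n hn
    change IsZero (s n).A
    rw [hs₀ n hn.le]
    exact hA₀'
  · obtain ⟨m, rfl⟩ : ∃ m, n = m + 1 := ⟨n - 1, by ring⟩
    have := (s (m + 1)).epi
    have := (s (m + 1 + 1)).mono_i
    rw [quasiIsoAt_iff_isIso_homologyMap]
    have : Mono (HomologicalComplex.homologyMap φ (m + 1)) := by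
      rw [HomologicalComplex.mono_homologyMap_iff_up_to_refinements φ m (m + 1) (m + 1 + 1)
        (by simp) (by simp)]
      intro T x hx y hxy
      rw [hF, ← Category.assoc] at hx
      obtain ⟨w, rfl⟩ := hδ₃ (m + 1) x (zero_of_comp_mono _ hx)
      have hw : w ≫ (s (m + 1)).z = y ≫ E.toCycles m (m + 1) := by
        rw [← cancel_mono (E.iCycles (m + 1))]
        simpa [(s (m + 1)).z_fac] using hxy
      obtain ⟨T', π, hπ, v, hv⟩ := hδ₄ m w (by rw [reassoc_of% hw]; simp)
      exact ⟨T', π, hπ, v, by rw [hF, reassoc_of% hv]⟩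
    have : Epi (HomologicalComplex.homologyMap φ (m + 1)) := by
      rw [HomologicalComplex.epi_homologyMap_iff_up_to_refinements φ m (m + 1) (m + 1 + 1)
        (by simp) (by simp)]
      intro T y hy
      obtain ⟨T', π, hπ, w, hw⟩ := surjective_up_to_refinements_of_epi
        ((s (m + 1)).z ≫ E.homologyπ (m + 1))
        (E.liftCycles y (m + 1 + 1) (by simp) hy ≫ E.homologyπ (m + 1))
      simp only [← Category.assoc] at hw
      obtain ⟨T'', π', hπ', v, hv⟩ := (E.comp_homologyπ_eq_iff_up_to_refinements m (m + 1)
        (by simp) _ _).1 hw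
      refine ⟨T'', π' ≫ π, inferInstance, π' ≫ w ≫ (s (m + 1)).i, ?_, v, ?_⟩
      · rw [hF]
        simp [reassoc_of% (hδ₂ (m + 1))]
      · simpa [(s (m + 1)).z_fac] using congr($hv ≫ E.iCycles (m + 1))
    exact isIso_of_mono_of_epi _

end CochainComplex

/-! ### Local sections, associated sheaves and epimorphisms of modules. -/

namespace AlgebraicGeometry.Scheme.Modules

open TopologicalSpace Opposite

variable {X : Scheme.{u}}

theorem section_ext_of_locally_eq (M : X.Modules) {U : X.Opens} (s t : Γ(M, U))
    (h : ∀ x ∈ U, ∃ (V : X.Opens) (hV : V ≤ U), x ∈ V ∧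
      M.presheaf.map (homOfLE hV).op s = M.presheaf.map (homOfLE hV).op t) : s = t := by
  choose V hVU hx hV using fun x : U ↦ h x x.2
  exact TopCat.Sheaf.eq_of_locally_eq' ⟨M.presheaf, M.isSheaf⟩ V U (fun x ↦ homOfLE (hVU x))
    (fun x hxU ↦ Opens.mem_iSup.2 ⟨⟨x, hxU⟩, hx ⟨x, hxU⟩⟩) s t hV

theorem subsingleton_sections_bot (M : X.Modules) : Subsingleton Γ(M, (⊥ : X.Opens)) :=
  ⟨fun s t ↦ section_ext_of_locally_eq M s t fun _ hx ↦ hx.elim⟩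

theorem Hom.app_map_apply {M N : X.Modules} (φ : M ⟶ N) {U V : X.Opens} (h : V ≤ U)
    (s : Γ(M, U)) :
    φ.app V (M.presheaf.map (homOfLE h).op s) = N.presheaf.map (homOfLE h).op (φ.app U s) :=
  congr($(φ.mapPresheaf.naturality (homOfLE h).op) s)

theorem map_map_apply (M : X.Modules) {U V W : X.Opens} (h : V ≤ U) (h' : W ≤ V)
    (s : Γ(M, U)) :
    M.presheaf.map (homOfLE h').op (M.presheaf.map (homOfLE h).op s) =
      M.presheaf.map (homOfLE (h'.trans h)).op s := by
  rw [← ConcreteCategory.comp_apply, ← Functor.map_comp]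
  rfl

theorem epi_of_locally_surjective {M N : X.Modules} (φ : M ⟶ N)
    (h : ∀ (U : X.Opens) (s : Γ(N, U)), ∀ x ∈ U, ∃ (V : X.Opens) (hV : V ≤ U), x ∈ V ∧
      ∃ t : Γ(M, V), φ.app V t = N.presheaf.map (homOfLE hV).op s) : Epi φ where
  left_cancellation {K} f g hfg := by
    ext U s
    refine section_ext_of_locally_eq K _ _ fun x hx ↦ ?_
    obtain ⟨V, hV, hxV, t, ht⟩ := h U s x hx
    refine ⟨V, hV, hxV, ?_⟩
    rw [← Hom.app_map_apply, ← Hom.app_map_apply, ← ht]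
    exact congr(Hom.app $hfg V t)

variable (X) in
/-- The sheaf of modules associated to a presheaf of modules. -/
noncomputable def associatedSheaf : X.PresheafOfModules ⥤ X.Modules :=
  PresheafOfModules.sheafification (𝟙 X.ringCatSheaf.obj)

variable (X) in
/-- The associated sheaf is left adjoint to the inclusion of sheaves into presheaves. -/
noncomputable def associatedSheafAdjunction : associatedSheaf X ⊣ toPresheafOfModules X :=
  PresheafOfModules.sheafificationAdjunction (𝟙 X.ringCatSheaf.obj)

/-- The canonical map from the sections of a presheaf to those of the associated sheaf. -/
noncomputable def toAssociatedSheaf (P : X.PresheafOfModules) (U : X.Opens) :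
    P.presheaf.obj (op U) ⟶ Γ((associatedSheaf X).obj P, U) :=
  (CategoryTheory.toSheafify (Opens.grothendieckTopology X) P.presheaf).app (op U)

theorem toAssociatedSheaf_locally_surjective (P : X.PresheafOfModules) (U : X.Opens)
    (s : Γ((associatedSheaf X).obj P, U)) (x : X) (hx : x ∈ U) :
    ∃ (V : X.Opens) (hV : V ≤ U), x ∈ V ∧ ∃ t : P.presheaf.obj (op V),
      toAssociatedSheaf P V t =
        ((associatedSheaf X).obj P).presheaf.map (homOfLE hV).op s := by
  obtain ⟨V, i, ⟨t, ht⟩, hxV⟩ := Presheaf.imageSieve_mem (Opens.grothendieckTopology X)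
    (CategoryTheory.toSheafify (Opens.grothendieckTopology X) P.presheaf) s x hx
  exact ⟨V, i.le, hxV, t, ht⟩

theorem toAssociatedSheaf_locally_injective (P : X.PresheafOfModules) (U : X.Opens)
    (s : P.presheaf.obj (op U)) (hs : toAssociatedSheaf P U s = 0) (x : X) (hx : x ∈ U) :
    ∃ (V : X.Opens) (hV : V ≤ U), x ∈ V ∧ P.presheaf.map (homOfLE hV).op s = 0 := by
  obtain ⟨V, i, h, hxV⟩ := Presheaf.equalizerSieve_mem (Opens.grothendieckTopology X)
    (CategoryTheory.toSheafify (Opens.grothendieckTopology X) P.presheaf) s 0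
    (hs.trans (map_zero _).symm) x hx
  exact ⟨V, i.le, hxV, h.trans (map_zero _)⟩

/-- The map from `N` to the sheaf associated to the presheaf cokernel vanishes after composition
with the epimorphism `φ`, hence vanishes. So the class of `s` in the presheaf cokernel is locally
zero, and exactness of presheaves over a small open set yields the lift. -/
theorem exists_local_lift {M N : X.Modules} (φ : M ⟶ N) [Epi φ] (U : X.Opens) (s : Γ(N, U))
    (x : X) (hx : x ∈ U) : ∃ (V : X.Opens) (hV : V ≤ U), x ∈ V ∧
      ∃ t : Γ(M, V), φ.app V t = N.presheaf.map (homOfLE hV).op s := by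
  let ψ := (toPresheafOfModules X).map φ
  let P := cokernel ψ
  let g : N ⟶ (associatedSheaf X).obj P := (toPresheafOfModules X).preimage
    (cokernel.π ψ ≫ (associatedSheafAdjunction X).unit.app P)
  have hg : g = 0 := by
    rw [← cancel_epi φ, comp_zero]
    apply (toPresheafOfModules X).map_injective
    simp [g, ψ, P]
  let q : Γ(N, U) ⟶ P.presheaf.obj (op U) :=
    ((PresheafOfModules.toPresheaf _).map (cokernel.π ψ)).app (op U)
  have hq : toAssociatedSheaf P U (q s) = 0 := by
    have h1 : (toPresheafOfModules X).map g = 0 := by rw [hg]; simp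
    simp only [g, Functor.map_preimage] at h1
    have h2 := congr(((PresheafOfModules.toPresheaf _).map $h1).app (op U) s)
    exact h2
  obtain ⟨V, hV, hxV, h⟩ := toAssociatedSheaf_locally_injective P U (q s) hq x hx
  refine ⟨V, hV, hxV, ?_⟩
  have hex : (ShortComplex.mk ψ (cokernel.π ψ) (cokernel.condition ψ)).Exact :=
    ShortComplex.exact_of_g_is_cokernel _ (cokernelIsCokernel ψ)
  have hex' := (ShortComplex.moduleCat_exact_iff _).1
    (hex.map (PresheafOfModules.evaluation _ (op V)))
  refine hex' (N.presheaf.map (homOfLE hV).op s) ?_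
  refine Eq.trans ?_ h
  exact congr($(((PresheafOfModules.toPresheaf _).map (cokernel.π ψ)).naturality
    (homOfLE hV).op) s)

theorem app_injective_of_mono {M N : X.Modules} (φ : M ⟶ N) [Mono φ] (U : X.Opens) :
    Function.Injective (φ.app U) := by
  have : Mono ((toPresheaf X).map φ) := inferInstance
  have := (NatTrans.mono_iff_mono_app _).1 this (op U)
  exact (AddCommGrpCat.mono_iff_injective _).1 this

section Universal

variable (S : Scheme.{u}) (V : S.Opens)

/-- The global section `1` of the structure sheaf. -/
noncomputable def structureSheafModule.one (X : Scheme.{u}) (U : X.Opens) :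
    Γ(structureSheafModule X, U) := (1 : Γ(X, U))

/-- The universal section of `𝒪_{S,V}` over `V`. -/
noncomputable def extendedStructureSheaf.unitSection : Γ(extendedStructureSheaf S V, V) :=
  (extendedStructureSheaf S V).presheaf.map (eqToHom V.ι_image_top.symm).op
    (Hom.app ((extensionByZeroAdjunction V.ι).unit.app (structureSheafModule V)) ⊤
      (structureSheafModule.one _ _))

end Universal

end AlgebraicGeometry.Scheme.Modules

/-! ### Cardinal estimates. -/

namespace Cardinal

variable {κ : Cardinal.{u}}

theorem mk_sigma_le_of_le (hκ : ℵ₀ ≤ κ) {ι : Type u} {f : ι → Type u} (hι : #ι ≤ κ)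
    (hf : ∀ i, #(f i) ≤ κ) : #(Σ i, f i) ≤ κ := by
  rw [mk_sigma]
  calc sum (fun i ↦ #(f i)) ≤ sum (fun _ : ι ↦ κ) := sum_le_sum _ _ hf
    _ = #ι * κ := by simp
    _ ≤ κ * κ := by gcongr
    _ = κ := mul_eq_self hκ

theorem mk_finset_le_of_le (hκ : ℵ₀ ≤ κ) {α : Type u} (hα : #α ≤ κ) : #(Finset α) ≤ κ := by
  cases finite_or_infinite α
  · exact (lt_aleph0_of_finite (Finset α)).le.trans hκ
  · rwa [mk_finset_of_infinite]

theorem mk_finsupp_le_of_le (hκ : ℵ₀ ≤ κ) {α β : Type u} [Zero β] (hα : #α ≤ κ) (hβ : #β ≤ κ) :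
    #(α →₀ β) ≤ κ :=
  (mk_le_of_injective (Finsupp.graph_injective α β)).trans <| mk_finset_le_of_le hκ <| by
    rw [mk_prod, lift_id, lift_id]
    exact (mul_le_mul' hα hβ).trans (mul_eq_self hκ).le

end Cardinal

/-- Every open subset of a Noetherian space is compact, hence a finite union of basic ones. -/
theorem TopologicalSpace.Opens.mk_le_of_isBasis {κ : Cardinal.{u}} (hκ : ℵ₀ ≤ κ) {α : Type u}
    [TopologicalSpace α] [NoetherianSpace α] {B : Set (Opens α)} (hB : Opens.IsBasis B)
    (hBκ : #B ≤ κ) : #(Opens α) ≤ κ := by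
  refine (Cardinal.mk_le_of_surjective (f := fun s : Finset B ↦ sSup (Subtype.val '' (s : Set B)))
    fun U ↦ ?_).trans (Cardinal.mk_finset_le_of_le hκ hBκ)
  obtain ⟨Us, hUs, hfin, rfl⟩ := hB.exists_finite_of_isCompact (NoetherianSpace.isCompact U.1)
  refine ⟨(hfin.preimage Subtype.val_injective.injOn).toFinset, ?_⟩
  simp [Set.inter_eq_self_of_subset_right hUs]

/-! ### Modules with at most κ sections over each open set. -/

namespace AlgebraicGeometry.Scheme.Modules

open TopologicalSpace Opposite

variable {X : Scheme.{u}} {κ : Cardinal.{u}}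

/-- A scheme with a Noetherian underlying space which has at most `κ` open subsets, for an
infinite cardinal `κ`. -/
structure HasOpensLE (κ : Cardinal.{u}) (X : Scheme.{u}) : Prop where
  aleph0_le : ℵ₀ ≤ κ
  noetherianSpace : NoetherianSpace X
  opens_le : #X.Opens ≤ κ

/-- By compactness of `U`, finitely many pairs of an open set and a local datum determine a section,
and there are at most κ finite sets of such pairs. -/
theorem HasOpensLE.sections_le (hX : HasOpensLE κ X) (N : X.Modules) (U : X.Opens)
    {T : X.Opens → Type u} (hT : ∀ V, #(T V) ≤ κ) (g : ∀ V, T V → Γ(N, V))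
    (h : ∀ (s : Γ(N, U)), ∀ x ∈ U, ∃ (V : X.Opens) (hV : V ≤ U), x ∈ V ∧
      ∃ t : T V, g V t = N.presheaf.map (homOfLE hV).op s) : #Γ(N, U) ≤ κ := by
  have := hX.noetherianSpace
  have key (s : Γ(N, U)) : ∃ F : Finset (Σ V, T V), (U : Set X) ⊆ ⋃ a ∈ F, (a.1 : Set X) ∧
      ∀ a ∈ F, ∃ hV : a.1 ≤ U, g a.1 a.2 = N.presheaf.map (homOfLE hV).op s := by
    choose V hV hxV t ht using fun x : U ↦ h s x x.2
    obtain ⟨F, hF⟩ := (NoetherianSpace.isCompact (U : Set X)).elim_finite_subcover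
      (fun x ↦ (V x : Set X)) (fun x ↦ (V x).isOpen)
      (fun x hx ↦ Set.mem_iUnion.2 ⟨⟨x, hx⟩, hxV ⟨x, hx⟩⟩)
    classical
    refine ⟨F.image fun x ↦ ⟨V x, t x⟩, by rwa [Finset.set_biUnion_finset_image], ?_⟩
    simp only [Finset.mem_image]
    rintro _ ⟨x, _, rfl⟩
    exact ⟨hV x, ht x⟩
  choose F hF hF' using key
  refine (Cardinal.mk_le_of_injective (f := F) fun s s' hs ↦ ?_).trans
    (Cardinal.mk_finset_le_of_le hX.aleph0_le
      (Cardinal.mk_sigma_le_of_le hX.aleph0_le hX.opens_le hT))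
  refine section_ext_of_locally_eq N s s' fun x hx ↦ ?_
  obtain ⟨a, ha, hxa⟩ : ∃ a ∈ F s, x ∈ a.1 := by simpa using hF s hx
  obtain ⟨hV, h₁⟩ := hF' s a ha
  obtain ⟨_, h₂⟩ := hF' s' a (hs ▸ ha)
  exact ⟨a.1, hV, hxa, h₁.symm.trans h₂⟩

theorem HasOpensLE.sections_le_of_locally (hX : HasOpensLE κ X) (N : X.Modules) (U : X.Opens)
    (h : ∀ x ∈ U, ∃ V ≤ U, x ∈ V ∧ #Γ(N, V) ≤ κ) : #Γ(N, U) ≤ κ :=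
  -- The data over `V` are all sections if there are at most κ of them, and empty otherwise.
  hX.sections_le N U (T := fun V ↦ { _s : Γ(N, V) // #Γ(N, V) ≤ κ })
    (fun V ↦ by
      by_cases hV : #Γ(N, V) ≤ κ
      · exact (Cardinal.mk_subtype_le _).trans hV
      · simp [hV])
    (fun V ↦ Subtype.val) (fun s x hx ↦ by
      obtain ⟨V, hV, hxV, hc⟩ := h x hx
      exact ⟨V, hV, hxV, ⟨_, hc⟩, rfl⟩)

/-- Modules all of whose sections over open subsets form sets of cardinality at most `κ`. -/
def sectionsLE (κ : Cardinal.{u}) (X : Scheme.{u}) : ObjectProperty X.Modules :=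
  fun M ↦ ∀ U : X.Opens, #Γ(M, U) ≤ κ

instance : (sectionsLE κ X).IsClosedUnderSubobjects where
  prop_of_mono f _ h U := (Cardinal.mk_le_of_injective (app_injective_of_mono f U)).trans (h U)

theorem HasOpensLE.sectionsLE_of_epi (hX : HasOpensLE κ X) {M N : X.Modules} (φ : M ⟶ N) [Epi φ]
    (hM : sectionsLE κ X M) : sectionsLE κ X N := fun U ↦
  hX.sections_le N U hM (fun V ↦ φ.app V) (exists_local_lift φ U)

theorem HasOpensLE.sectionsLE_associatedSheaf (hX : HasOpensLE κ X) (P : X.PresheafOfModules)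
    (hP : ∀ U : X.Opens, #(P.presheaf.obj (op U)) ≤ κ) :
    sectionsLE κ X ((associatedSheaf X).obj P) := fun U ↦
  hX.sections_le _ U hP (fun V ↦ toAssociatedSheaf P V)
    (toAssociatedSheaf_locally_surjective P U)

theorem sectionsLE_coproduct (hκ : ℵ₀ ≤ κ) {ι : Type} [Finite ι] (M : ι → X.Modules)
    (hM : ∀ i, sectionsLE κ X (M i)) : sectionsLE κ X (∐ M) := by
  classical
  cases nonempty_fintype ι
  intro U
  have hπ : ∀ s : Γ(∐ M, U), s = ∑ i, (Sigma.ι M i).app U ((Sigma.π M i).app U s) := by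
    intro s
    have h1 : 𝟙 (∐ M) = ∑ i, Sigma.π M i ≫ Sigma.ι M i := by
      refine Sigma.hom_ext _ _ fun j ↦ ?_
      rw [Preadditive.comp_sum, Finset.sum_eq_single j]
      · simp
      · intro i _ hij
        rw [Sigma.ι_π_of_ne_assoc _ hij.symm, zero_comp]
      · simp
    let e : (∐ M ⟶ ∐ M) →+ Γ(∐ M, U) := AddMonoidHom.mk' (fun f ↦ f.app U s) fun _ _ ↦ rfl
    have h2 := congr(e $h1)
    rw [map_sum] at h2
    exact h2
  have : #(∀ i, Γ(M i, U)) ≤ κ := by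
    rw [Cardinal.mk_pi]
    refine (Cardinal.prod_le_prod _ (fun _ ↦ κ) fun i ↦ hM i U).trans ?_
    simpa using Cardinal.power_nat_le hκ
  refine (Cardinal.mk_le_of_injective
    (f := fun s i ↦ (Sigma.π M i).app U s) fun s t h ↦ ?_).trans this
  rw [hπ s, hπ t]
  exact Finset.sum_congr rfl fun i _ ↦ congr((Sigma.ι M i).app U $(congrFun h i))

/-! ### Morphisms out of 𝒪_{S,V} as sections over V. -/

section Universal

theorem structureSheafModule.hom_app_apply {N : X.Modules} (f : structureSheafModule X ⟶ N)
    (U : X.Opens) (r : Γ(X, U)) :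
    f.app U (r : Γ(structureSheafModule X, U)) = r • f.app U (one X U) := by
  rw [← Hom.app_smul]
  congr 1
  exact (mul_one r).symm

theorem structureSheafModule.map_one {U V : X.Opens} (h : V ≤ U) :
    (structureSheafModule X).presheaf.map (homOfLE h).op (one X U) = one X V :=
  _root_.map_one (X.presheaf.map (homOfLE h).op).hom

theorem structureSheafModule.hom_ext {N : X.Modules} {f g : structureSheafModule X ⟶ N}
    (h : f.app ⊤ (one X ⊤) = g.app ⊤ (one X ⊤)) : f = g := by
  ext U r
  have (k : structureSheafModule X ⟶ N) :
      k.app U (one X U) = N.presheaf.map (homOfLE le_top).op (k.app ⊤ (one X ⊤)) := by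
    rw [← Hom.app_map_apply, map_one]
  refine (hom_app_apply f U r).trans (Eq.trans ?_ (hom_app_apply g U r).symm)
  rw [this, this, h]

theorem structureSheafModule.exists_hom {N : X.Modules} (s : Γ(N, ⊤)) :
    ∃ f : structureSheafModule X ⟶ N, f.app ⊤ (one X ⊤) = s := by
  let t : SheafOfModules.sections N := PresheafOfModules.sectionsMk
    (fun U ↦ N.presheaf.map (homOfLE (le_top : U.unop ≤ ⊤)).op s)
    (fun U V i ↦ map_map_apply N le_top i.unop.le s)
  refine ⟨(SheafOfModules.unitHomEquiv N).symm t, ?_⟩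
  have h1 := SheafOfModules.unitHomEquiv_apply_coe N ((SheafOfModules.unitHomEquiv N).symm t) (op ⊤)
  rw [Equiv.apply_symm_apply] at h1
  refine h1.symm.trans ?_
  change N.presheaf.map (homOfLE (le_top : (⊤ : X.Opens) ≤ ⊤)).op s = s
  exact congr($(N.presheaf.map_id (op ⊤)) s)

variable {S : Scheme.{u}} {V : S.Opens}

theorem presheaf_map_eqToHom_bijective (M : S.Modules) {U V : S.Opens} (h : U = V) :
    Function.Bijective (M.presheaf.map (eqToHom h.symm).op : Γ(M, U) ⟶ Γ(M, V)) := by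
  subst h
  simpa using Function.bijective_id

namespace extendedStructureSheaf

variable (V) in
/-- Morphisms `𝒪_{S,V} ⟶ M` are morphisms from the structure sheaf of `V` to `M|_V`. -/
noncomputable def homEquiv (M : S.Modules) :
    (extendedStructureSheaf S V ⟶ M) ≃ (structureSheafModule (V : Scheme.{u}) ⟶ M.restrict V.ι) :=
  (extensionByZeroAdjunction V.ι).homEquiv _ _

theorem app_unitSection {M : S.Modules} (f : extendedStructureSheaf S V ⟶ M) :
    f.app V (unitSection S V) = M.presheaf.map (eqToHom V.ι_image_top.symm).op
      ((homEquiv V M f).app ⊤ (structureSheafModule.one _ _)) := by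
  have h : homEquiv V M f = (extensionByZeroAdjunction V.ι).unit.app _ ≫
    (restrictFunctor V.ι).map f := Adjunction.homEquiv_unit ..
  rw [h]
  exact Hom.app_map_apply f V.ι_image_top.ge _

theorem hom_ext {M : S.Modules} {f g : extendedStructureSheaf S V ⟶ M}
    (h : f.app V (unitSection S V) = g.app V (unitSection S V)) : f = g := by
  rw [app_unitSection, app_unitSection] at h
  exact (homEquiv V M).injective
    (structureSheafModule.hom_ext ((presheaf_map_eqToHom_bijective M V.ι_image_top).1 h))

theorem exists_hom {M : S.Modules} (s : Γ(M, V)) :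
    ∃ f : extendedStructureSheaf S V ⟶ M, f.app V (unitSection S V) = s := by
  obtain ⟨t, rfl⟩ := (presheaf_map_eqToHom_bijective M V.ι_image_top).2 s
  obtain ⟨f, hf⟩ := structureSheafModule.exists_hom (N := M.restrict V.ι) t
  refine ⟨(homEquiv V M).symm f, ?_⟩
  rw [app_unitSection, Equiv.apply_symm_apply, hf]

/-- The morphism `𝒪_{S,V} ⟶ M` given by a section of `M` over `V`. -/
noncomputable def desc {M : S.Modules} (s : Γ(M, V)) : extendedStructureSheaf S V ⟶ M :=
  (exists_hom s).choose

theorem desc_app {M : S.Modules} (s : Γ(M, V)) : (desc s).app V (unitSection S V) = s :=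
  (exists_hom s).choose_spec

end extendedStructureSheaf

end Universal

end AlgebraicGeometry.Scheme.Modules

/-! ### The direct sums in 𝒟_S: size, covering property, closure under finite sums. -/

namespace AlgebraicGeometry.Scheme.Modules

open TopologicalSpace Opposite extendedStructureSheaf

variable {S : Scheme.{u}} {κ : Cardinal.{u}} {J : Type u}

/-- The presheaf of sets `⨆_j h_{V_j}`, whose sections over `U` are the `j` with `U ⊆ V_j`. -/
def indexPresheaf (V : J → S.Opens) : S.Opensᵒᵖ ⥤ Type u where
  obj U := { j : J // U.unop ≤ V j }
  map i := ↾fun j ↦ ⟨j.1, i.unop.le.trans j.2⟩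

/-- The free presheaf of modules whose associated sheaf is `⨁ 𝒪_{S,V_j}`. -/
noncomputable def freeIndexPresheaf (V : J → S.Opens) : S.PresheafOfModules :=
  PresheafOfModules.freeObj (R := S.ringCatSheaf.obj) (indexPresheaf V)

/-- The generator of `freeIndexPresheaf V` over `V j`. -/
noncomputable def freeIndexPresheaf.generator (V : J → S.Opens) (j : J) :
    (freeIndexPresheaf V).presheaf.obj (op (V j)) :=
  ModuleCat.freeMk (R := S.ringCatSheaf.obj.obj (op (V j))) (⟨j, le_rfl⟩ : { i // V j ≤ V i })

theorem freeIndexPresheaf.exists_hom (V : J → S.Opens) (M : S.Modules) (s : ∀ j, Γ(M, V j)) :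
    ∃ φ : (associatedSheaf S).obj (freeIndexPresheaf V) ⟶ M,
      ∀ j, φ.app (V j) (toAssociatedSheaf _ _ (generator V j)) = s j := by
  let ψ : freeIndexPresheaf V ⟶ (toPresheafOfModules S).obj M :=
    PresheafOfModules.freeObjDesc
      { app := fun U ↦ ↾fun j : { j : J // U.unop ≤ V j } ↦
          M.presheaf.map (homOfLE j.2).op (s j.1)
        naturality := fun U U' i ↦ by
          ext j
          exact (map_map_apply M j.2 i.unop.le (s j.1)).symm }
  refine ⟨((associatedSheafAdjunction S).homEquiv _ _).symm ψ, fun j ↦ ?_⟩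
  have h := (associatedSheafAdjunction S).homEquiv_unit
    (f := ((associatedSheafAdjunction S).homEquiv _ _).symm ψ)
  rw [Equiv.apply_symm_apply] at h
  have h1 := congr(((PresheafOfModules.toPresheaf _).map $h).app (op (V j)) (generator V j))
  refine Eq.trans h1.symm ?_
  refine (ModuleCat.freeDesc_apply _ _).trans ?_
  exact congr($(M.presheaf.map_id (op (V j))) (s j))

/-- The direct sum is a retract of the sheaf associated to the free presheaf, whose sections over
`U` are finitely supported families in Γ(S, U). A retract suffices for the bound, so extension by
zero need not be computed. -/
theorem HasOpensLE.sectionsLE_coproduct_extendedStructureSheaf (hS : HasOpensLE κ S)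
    (hO : ∀ U : S.Opens, #Γ(S, U) ≤ κ) (hJ : #J ≤ κ) (V : J → S.Opens) :
    sectionsLE κ S (∐ fun j ↦ extendedStructureSheaf S (V j)) := by
  let M := ∐ fun j ↦ extendedStructureSheaf S (V j)
  obtain ⟨φ, hφ⟩ := freeIndexPresheaf.exists_hom V M
    fun j ↦ (Sigma.ι (fun j ↦ extendedStructureSheaf S (V j)) j).app _ (unitSection S (V j))
  let ψ : M ⟶ (associatedSheaf S).obj (freeIndexPresheaf V) :=
    Sigma.desc fun j ↦ desc (toAssociatedSheaf _ _ (freeIndexPresheaf.generator V j))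
  have h : ψ ≫ φ = 𝟙 M := by
    refine Sigma.hom_ext _ _ fun j ↦ extendedStructureSheaf.hom_ext ?_
    rw [Sigma.ι_desc_assoc, Category.comp_id, ← hφ j, Hom.comp_app, ConcreteCategory.comp_apply,
      desc_app]
  have : IsSplitEpi φ := ⟨⟨ψ, h⟩⟩
  refine hS.sectionsLE_of_epi φ (hS.sectionsLE_associatedSheaf _ fun U ↦ ?_)
  exact Cardinal.mk_finsupp_le_of_le hS.aleph0_le ((Cardinal.mk_subtype_le _).trans hJ) (hO U)

theorem HasOpensLE.exists_epi_of_epi (hS : HasOpensLE κ S) (hJ : #J = κ) {M N : S.Modules}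
    (p : M ⟶ N) [Epi p] (hN : sectionsLE κ S N) :
    ∃ (A : S.Modules) (a : A ⟶ M), directSumProperty S J A ∧ Epi (a ≫ p) := by
  -- Only sections that lift along `p` over their whole domain are indexed; as `p` is locally
  -- surjective, these generate `N`.
  let I := Σ U : S.Opens, { s : Γ(N, U) // ∃ t, p.app U t = s }
  have hI : #I ≤ #J := hJ ▸ Cardinal.mk_sigma_le_of_le hS.aleph0_le hS.opens_le
    fun U ↦ (Cardinal.mk_subtype_le _).trans (hN U)
  -- With `I` nonempty, `J` maps onto it: repetitions bring the index set to cardinality exactly κ.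
  have : Nonempty I := ⟨⟨⊥, 0, 0, map_zero _⟩⟩
  obtain ⟨e⟩ := (Cardinal.le_def _ _).1 hI
  let f : J → I := Function.invFun e
  have hf : Function.Surjective f := Function.invFun_surjective e.injective
  let a : (∐ fun j ↦ extendedStructureSheaf S (f j).1) ⟶ M :=
    Sigma.desc fun j ↦ desc (f j).2.2.choose
  refine ⟨_, a, ⟨fun j ↦ (f j).1⟩, ?_⟩
  have key (i : I) : ∃ w, (a ≫ p).app i.1 w = i.2.1 := by
    obtain ⟨j, rfl⟩ := hf i
    refine ⟨(Sigma.ι (fun j ↦ extendedStructureSheaf S (f j).1) j).app _ (unitSection _ _), ?_⟩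
    rw [← ConcreteCategory.comp_apply, ← Hom.comp_app, Sigma.ι_desc_assoc, Hom.comp_app,
      ConcreteCategory.comp_apply, desc_app]
    exact (f j).2.2.choose_spec
  refine epi_of_locally_surjective _ fun U s x hx ↦ ?_
  obtain ⟨V, hV, hxV, t, ht⟩ := exists_local_lift p U s x hx
  exact ⟨V, hV, hxV, key ⟨V, _, t, ht⟩⟩

/-- A coproduct over a disjoint union is the direct sum of the two partial coproducts. -/
noncomputable def coproductSumIso {ι ι' : Type u} (X : ι ⊕ ι' → S.Modules) :
    ∐ X ≅ (∐ fun i ↦ X (.inl i)) ⊞ (∐ fun i ↦ X (.inr i)) where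
  hom := Sigma.desc (Sum.rec (fun i ↦ Sigma.ι (fun i ↦ X (.inl i)) i ≫ biprod.inl)
    (fun i ↦ Sigma.ι (fun i ↦ X (.inr i)) i ≫ biprod.inr))
  inv := biprod.desc (Sigma.desc fun i ↦ Sigma.ι X (.inl i)) (Sigma.desc fun i ↦ Sigma.ι X (.inr i))
  hom_inv_id := by
    refine Sigma.hom_ext _ _ ?_
    rintro (i | i) <;> simp
  inv_hom_id := by
    apply biprod.hom_ext' <;> refine Sigma.hom_ext _ _ fun i ↦ ?_ <;> simp

theorem directSumProperty_biprod [Infinite J] {A B : S.Modules} (hA : directSumProperty S J A)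
    (hB : directSumProperty S J B) :
    ∃ D, directSumProperty S J D ∧ Nonempty (D ≅ A ⊞ B) := by
  obtain ⟨V⟩ := hA
  obtain ⟨W⟩ := hB
  obtain ⟨e⟩ : Nonempty (J ≃ J ⊕ J) := Cardinal.eq.1 (by simp)
  let X : J ⊕ J → S.Modules := fun i ↦ extendedStructureSheaf S (Sum.elim V W i)
  exact ⟨_, ⟨fun j ↦ Sum.elim V W (e j)⟩, ⟨Sigma.reindex e X ≪≫ coproductSumIso X⟩⟩

theorem directSumProperty_exists_isZero (S : Scheme.{u}) (J : Type u) :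
    ∃ A, directSumProperty S J A ∧ IsZero A := by
  refine ⟨_, ⟨fun _ ↦ ⊥⟩, ?_⟩
  rw [IsZero.iff_id_eq_zero]
  refine Sigma.hom_ext _ _ fun j ↦ extendedStructureSheaf.hom_ext ?_
  exact (subsingleton_sections_bot _).elim _ _

theorem HasOpensLE.exists_quasiIso (hS : HasOpensLE κ S) (hO : ∀ U : S.Opens, #Γ(S, U) ≤ κ)
    (hJ : #J = κ) (E : CochainComplex S.Modules ℤ) (hE : IsCohomologicallyBoundedAbove E)
    (hE' : HasCohomologySectionsLE κ E) :
    ∃ (F : CochainComplex S.Modules ℤ) (φ : F ⟶ E),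
        (∀ n : ℤ, directSumProperty S J (F.X n)) ∧ (∃ N : ℤ, F.IsStrictlyLE N) ∧ QuasiIso φ := by
  obtain ⟨N, hN⟩ := hE
  have : Infinite J := Cardinal.infinite_iff.2 (hJ ▸ hS.aleph0_le)
  exact CochainComplex.exists_quasiIso_of_objectProperty (directSumProperty S J) (sectionsLE κ S)
    (by rintro _ ⟨V⟩; exact hS.sectionsLE_coproduct_extendedStructureSheaf hO hJ.le V)
    (directSumProperty_exists_isZero S J) (fun _ _ ↦ directSumProperty_biprod)
    (fun _ _ p _ ↦ hS.exists_epi_of_epi hJ p) hE' N hN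

end AlgebraicGeometry.Scheme.Modules

/-! ### Schemes of finite type over a field, and perfect complexes. -/

namespace AlgebraicGeometry.Scheme.Modules

open TopologicalSpace Opposite

variable {X Y : Scheme.{u}} {κ : Cardinal.{u}}

section FiniteType

variable {k : Type u} [Field k]

theorem mk_sections_le_of_isAffineOpen (p : X ⟶ Spec (CommRingCat.of k)) [LocallyOfFiniteType p]
    (hκ : ℵ₀ ≤ κ) (hk : #k ≤ κ) {U : X.Opens}
    (hU : IsAffineOpen U) : #Γ(X, U) ≤ κ := by
  have h := p.finiteType_appLE (isAffineOpen_top _) hU le_top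
  let e := (Scheme.ΓSpecIso (CommRingCat.of k)).commRingCatIsoToRingEquiv
  have h' : (((p.appLE ⊤ U le_top).hom).comp e.symm.toRingHom).FiniteType :=
    h.comp (RingHom.FiniteType.of_surjective _ e.symm.surjective)
  algebraize [((p.appLE ⊤ U le_top).hom).comp e.symm.toRingHom]
  obtain ⟨n, f, hf⟩ := Algebra.FiniteType.iff_quotient_mvPolynomial''.1 h'
  have h₁ : #(MvPolynomial (ULift.{u} (Fin n)) k) ≤ κ :=
    MvPolynomial.cardinalMk_le_max.trans
      (max_le (max_le hk ((Cardinal.lt_aleph0_of_finite _).le.trans hκ)) hκ)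
  rw [Cardinal.mk_congr (MvPolynomial.renameEquiv k Equiv.ulift).toEquiv] at h₁
  exact (Cardinal.mk_le_of_surjective hf).trans h₁

theorem hasOpensLE_of_locallyOfFiniteType (p : X ⟶ Spec (CommRingCat.of k)) [LocallyOfFiniteType p]
    [QuasiCompact p] (hκ : ℵ₀ ≤ κ) (hk : #k ≤ κ) :
    HasOpensLE κ X := by
  have : IsLocallyNoetherian X := LocallyOfFiniteType.isLocallyNoetherian p
  have : CompactSpace X := QuasiCompact.compactSpace_of_compactSpace p
  have : IsNoetherian X := {}
  refine ⟨hκ, inferInstance, ?_⟩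
  have (x : X) : ∃ U : X.Opens, IsAffineOpen U ∧ x ∈ U := by
    obtain ⟨_, ⟨U, hU, rfl⟩, hxU, _⟩ :=
      X.isBasis_affineOpens.exists_subset_of_mem_open (Set.mem_univ x) isOpen_univ
    exact ⟨U, hU, hxU⟩
  choose U hU hxU using this
  obtain ⟨F, hF⟩ := isCompact_univ.elim_finite_subcover
    (fun x ↦ (U x : Set X)) (fun x ↦ (U x).isOpen) (fun x _ ↦ Set.mem_iUnion.2 ⟨x, hxU x⟩)
  -- The basic open sets of a finite affine cover form a basis, indexed by at most κ functions.
  let b : (Σ x : F, Γ(X, U x)) → X.Opens := fun a ↦ X.basicOpen a.2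
  refine Opens.mk_le_of_isBasis hκ (B := Set.range b) ?_ (Cardinal.mk_range_le.trans
    (Cardinal.mk_sigma_le_of_le hκ ((Cardinal.lt_aleph0_of_finite _).le.trans hκ)
      fun x ↦ mk_sections_le_of_isAffineOpen p hκ hk (hU x)))
  rw [Opens.isBasis_iff_nbhd]
  intro W x hx
  obtain ⟨y, hy, hxy⟩ : ∃ y ∈ F, x ∈ U y := by simpa using hF (Set.mem_univ x)
  obtain ⟨f, hfW, hxf⟩ := (hU y).exists_basicOpen_le ⟨x, hx⟩ hxy
  exact ⟨_, ⟨⟨⟨y, hy⟩, f⟩, rfl⟩, hxf, hfW⟩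

theorem HasOpensLE.mk_sections_le (hX : HasOpensLE κ X) (p : X ⟶ Spec (CommRingCat.of k))
    [LocallyOfFiniteType p]
    (hk : #k ≤ κ) (U : X.Opens) : #Γ(X, U) ≤ κ := by
  refine hX.sections_le_of_locally (structureSheafModule X) U fun x hx ↦ ?_
  obtain ⟨_, ⟨V, hV, rfl⟩, hxV, hVU⟩ :=
    X.isBasis_affineOpens.exists_subset_of_mem_open hx U.isOpen
  exact ⟨V, hVU, hxV, mk_sections_le_of_isAffineOpen p hX.aleph0_le hk hV⟩

end FiniteType

theorem HasOpensLE.of_isOpenImmersion (hY : HasOpensLE κ Y) (f : X ⟶ Y) [IsOpenImmersion f] :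
    HasOpensLE κ X := by
  have := hY.noetherianSpace
  refine ⟨hY.aleph0_le, f.isOpenEmbedding.isInducing.noetherianSpace, ?_⟩
  exact (Cardinal.mk_le_of_injective f.image_injective).trans hY.opens_le

theorem HasOpensLE.sectionsLE_of_isVectorBundle (hX : HasOpensLE κ X)
    (hO : ∀ U : X.Opens, #Γ(X, U) ≤ κ) {M : X.Modules} (hM : IsVectorBundle M) :
    sectionsLE κ X M := by
  refine fun W ↦ hX.sections_le_of_locally M W fun x hx ↦ ?_
  obtain ⟨U, hxU, r, ⟨e⟩⟩ := hM x
  refine ⟨U ⊓ W, inf_le_right, ⟨hxU, hx⟩, ?_⟩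
  have h1 : sectionsLE κ _ (M.restrict U.ι) :=
    (sectionsLE κ (U : Scheme.{u})).prop_of_mono e.hom <|
      sectionsLE_coproduct hX.aleph0_le _ fun _ V ↦ hO (U.ι ''ᵁ V)
  have h2 := h1 (U.ι ⁻¹ᵁ W)
  change #Γ(M, U.ι ''ᵁ (U.ι ⁻¹ᵁ W)) ≤ κ at h2
  rwa [Hom.image_preimage_eq_opensRange_inf, Opens.opensRange_ι] at h2

theorem HasOpensLE.sectionsLE_homology (hX : HasOpensLE κ X) (E : CochainComplex X.Modules ℤ)
    (hE : ∀ n, sectionsLE κ X (E.X n)) (n : ℤ) : sectionsLE κ X (E.homology n) :=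
  hX.sectionsLE_of_epi (E.homologyπ n) ((sectionsLE κ X).prop_of_mono (E.iCycles n) (hE n))

/-- Restriction to an open subset commutes with cohomology sheaves. -/
theorem nonempty_homology_restrictComplex_iso (E : CochainComplex X.Modules ℤ) (U : X.Opens)
    (n : ℤ) : Nonempty ((restrictComplex E U).homology n ≅ (E.homology n).restrict U.ι) := by
  have : PreservesFiniteLimits (restrictFunctor U.ι) := inferInstance
  have : PreservesFiniteColimits (restrictFunctor U.ι) := inferInstance
  have : (restrictFunctor U.ι).PreservesHomology := inferInstance
  exact ⟨(E.sc n).mapHomologyIso (restrictFunctor U.ι)⟩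

theorem AreQuasiIsomorphic.nonempty_homology_iso {E E' : CochainComplex X.Modules ℤ}
    (h : AreQuasiIsomorphic E E') (n : ℤ) : Nonempty (E.homology n ≅ E'.homology n) := by
  obtain ⟨G, s, t, _, _⟩ := h
  exact ⟨(isoOfQuasiIsoAt s n).symm ≪≫ isoOfQuasiIsoAt t n⟩

theorem isZero_of_locally (M : X.Modules)
    (h : ∀ x : X, ∃ U : X.Opens, x ∈ U ∧ IsZero (M.restrict U.ι)) : IsZero M := by
  rw [IsZero.iff_id_eq_zero]
  ext W s
  refine section_ext_of_locally_eq M _ _ fun x hx ↦ ?_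
  obtain ⟨U, hxU, hU⟩ := h x
  have h1 : Subsingleton Γ(M.restrict U.ι, U.ι ⁻¹ᵁ W) := by
    refine ⟨fun s t ↦ ?_⟩
    have h2 (s) : s = (0 : Γ(M.restrict U.ι, U.ι ⁻¹ᵁ W)) :=
      congr(Hom.app $((IsZero.iff_id_eq_zero _).1 hU) _ s)
    rw [h2 s, h2 t]
  change Subsingleton Γ(M, U.ι ''ᵁ (U.ι ⁻¹ᵁ W)) at h1
  rw [Hom.image_preimage_eq_opensRange_inf, Opens.opensRange_ι] at h1
  exact ⟨U ⊓ W, inf_le_right, ⟨hxU, hx⟩, h1.elim _ _⟩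

theorem HasOpensLE.of_isPerfect (hX : HasOpensLE κ X) (hO : ∀ U : X.Opens, #Γ(X, U) ≤ κ)
    (E : CochainComplex X.Modules ℤ) (hE : IsPerfect E) :
    IsCohomologicallyBoundedAbove E ∧ HasCohomologySectionsLE κ E := by
  have := hX.noetherianSpace
  choose U hU P hP hPE using hE
  have iso (x : X) (n : ℤ) : Nonempty ((P x).homology n ≅ (E.homology n).restrict (U x).ι) := by
    obtain ⟨e⟩ := (hPE x).nonempty_homology_iso n
    obtain ⟨e'⟩ := nonempty_homology_restrictComplex_iso E (U x) n
    exact ⟨e ≪≫ e'⟩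
  constructor
  · choose a b ha hb using fun x ↦ (hP x).1
    obtain ⟨F, hF⟩ := isCompact_univ.elim_finite_subcover
      (fun x ↦ (U x : Set X)) (fun x ↦ (U x).isOpen) (fun x _ ↦ Set.mem_iUnion.2 ⟨x, hU x⟩)
    -- The sum is a convenient natural number exceeding every `b x` with `x ∈ F`.
    refine ⟨∑ x ∈ F, (b x + 1).toNat, fun n hn ↦ isZero_of_locally _ fun x ↦ ?_⟩
    obtain ⟨y, hy, hxy⟩ : ∃ y ∈ F, x ∈ U y := by simpa using hF (Set.mem_univ x)
    refine ⟨U y, hxy, ?_⟩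
    obtain ⟨e⟩ := iso y n
    refine IsZero.of_iso ?_ e.symm
    have h1 := Finset.single_le_sum (f := fun x ↦ (b x + 1).toNat) (fun _ _ ↦ Nat.zero_le _) hy
    have h2 : b y < n := by
      have : (b y + 1).toNat ≤ n := (Nat.cast_le.2 h1).trans hn
      omega
    have := hb y
    exact (P y).isZero_of_isLE (b y) n h2
  · intro n W
    refine hX.sections_le_of_locally _ W fun x hx ↦ ?_
    refine ⟨U x ⊓ W, inf_le_right, ⟨hU x, hx⟩, ?_⟩
    have hUx := hX.of_isOpenImmersion (U x).ι
    obtain ⟨e⟩ := iso x n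
    have h1 : sectionsLE κ _ ((E.homology n).restrict (U x).ι) :=
      (sectionsLE κ _).prop_of_mono e.inv <| hUx.sectionsLE_homology _
        (fun m ↦ hUx.sectionsLE_of_isVectorBundle (fun V ↦ hO ((U x).ι ''ᵁ V)) ((hP x).2 m)) n
    have h2 := h1 ((U x).ι ⁻¹ᵁ W)
    change #Γ(E.homology n, (U x).ι ''ᵁ ((U x).ι ⁻¹ᵁ W)) ≤ κ at h2
    rwa [Hom.image_preimage_eq_opensRange_inf, Opens.opensRange_ι] at h2

end AlgebraicGeometry.Scheme.Modules

theorem mainTheorem5 {k : Type u} [Field k]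
    (κ : Cardinal.{u}) (hκ : ℵ₀ ≤ κ) (hk : #k ≤ κ)
    (J : Type u) (hJ : #J = κ)
    (S : Scheme.{u}) (p : S ⟶ Spec (CommRingCat.of k)) [LocallyOfFiniteType p] [QuasiCompact p] :
    (∀ E : CochainComplex S.Modules ℤ,
      Scheme.Modules.IsCohomologicallyBoundedAbove E →
      Scheme.Modules.HasCohomologySectionsLE κ E →
      ∃ (F : CochainComplex S.Modules ℤ) (φ : F ⟶ E),
        (∀ n : ℤ, Scheme.Modules.directSumProperty S J (F.X n)) ∧
        (∃ N : ℤ, F.IsStrictlyLE N) ∧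
        QuasiIso φ) ∧
    (∀ E : CochainComplex S.Modules ℤ, Scheme.Modules.IsPerfect E →
      Scheme.Modules.IsCohomologicallyBoundedAbove E ∧
      Scheme.Modules.HasCohomologySectionsLE κ E) := by
  have hS : Scheme.Modules.HasOpensLE κ S :=
    Scheme.Modules.hasOpensLE_of_locallyOfFiniteType p hκ hk
  have hO := hS.mk_sections_le p hk
  exact ⟨hS.exists_quasiIso hO hJ, hS.of_isPerfect hO⟩
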